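/- Consider the discrete-time linear system $x(t+1)=Ax(t)+Bu(t)$, $y(t)=Cx(t)$ with $A\in\mathbb{R}^{n\times n}$, $B\in\mathbb{R}^{n\times m}$, $C\in\mathbb{R}^{l\times n}$, where $(A,B)$ is controllable and $(A,C)$ is observable. Let $Q\in\mathbb{R}^{l\times l}$ be symmetric with $Q\succeq 0$ and let $R\in\mathbb{R}^{m\times m}$ be symmetric with $R\succ 0$. Assume moreover that $(A,QC)$ is observable (equivalently, that $(A,Q^{1/2}C)$ is observable; this holds automatically if $Q\succ 0$). For $P\in\mathbb{R}^{n\times n}$ write $$\mathcal{R}(P)=A^{\top}PA-A^{\top}PB(R+B^{\top}PB)^{-1}B^{\top}PA+C^{\top}QC,\qquad \mathcal{K}(P)=(R+B^{\top}PB)^{-1}B^{\top}PA .$$ For a horizon $T$ let $P_T=C^{\top}QC$, $P_t=\mathcal{R}(P_{t+1})$ for $0\le t<T$, and $K_t=\mathcal{K}(P_{t+1})$ for $0\le t\le T-1$. Let $$F_u=\begin{bmatrix}A^{n-1}B&\cdots&AB&B\end{bmatrix},\qquad \mathcal{O}=\begin{bmatrix}C\\ CA\\ \vdots\\ CA^{n-1}\end{bmatrix},$$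 let $\mathcal{O}^{\dagger}$ be the Moore--Penrose pseudoinverse of $\mathcal{O}$, and let $\mathbf{S}$ be the strictly lower block triangular Toeplitz matrix with $n\times n$ blocks of size $l\times m$ whose $(i,j)$ block is $CA^{i-j-1}B$ for $i>j$ and $0$ for $i\le j$. Put $H=\begin{bmatrix}F_u-A^n\mathcal{O}^{\dagger}\mathbf{S}&A^n\mathcal{O}^{\dagger}\end{bmatrix}$ and define the time-varying input/output LQR gain $K_{\mathrm{LQR}}^{t}=K_tH$ for $0\le t\le T-1$. Then the algebraic Riccati equation $P=\mathcal{R}(P)$ has a unique symmetric positive definite solution $P^{*}$. With the stationary gains $K^{*}=\mathcal{K}(P^{*})$ and $K_{\mathrm{LQR}}^{*}=K^{*}H$, there are constants $c_1,c_2>0$ and $0<\mu<1$, depending only on $A,B,C,Q,R$, such that for every horizon $T$ and every $1\le t\le T$ $$\bigl\|K_{\mathrm{LQR}}^{T-t}-K_{\mathrm{LQR}}^{*}\bigr\|\le c_1c_2\,\mu^{t},$$ where $\|\cdot\|$ is the spectral norm. -/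

import Mathlib

open scoped Matrix Matrix.Norms.L2Operator

namespace LQR

/-! ### Moore–Penrose pseudoinverse of a real matrix -/

/-- `Y` is the Moore–Penrose pseudoinverse of `X`: the four Penrose equations. -/
structure IsMoorePenrose {p q : Type*} [Fintype p] [Fintype q]
    (X : Matrix p q ℝ) (Y : Matrix q p ℝ) : Prop where
  mul_mul_left : X * Y * X = X
  mul_mul_right : Y * X * Y = Y
  symm_left : (X * Y)ᵀ = X * Y
  symm_right : (Y * X)ᵀ = Y * X

/-- Every real matrix has a Moore–Penrose pseudoinverse. -/
theorem exists_isMoorePenrose {p q : Type*} [Fintype p] [Fintype q]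
    (X : Matrix p q ℝ) : ∃ Y : Matrix q p ℝ, IsMoorePenrose X Y := by
  classical
  have hG : (Xᵀ * X).IsHermitian := by
    simpa using Matrix.isHermitian_conjTranspose_mul_self X
  set d : q → ℝ := hG.eigenvalues with hd
  set U : Matrix q q ℝ := (hG.eigenvectorUnitary : Matrix q q ℝ) with hU
  have hUU : Uᵀ * U = 1 := by
    have := Unitary.coe_star_mul_self hG.eigenvectorUnitary
    simpa [Matrix.star_eq_conjTranspose] using this
  have hGe : Xᵀ * X = U * Matrix.diagonal d * Uᵀ := by
    have := hG.spectral_theorem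
    simpa [Unitary.conjStarAlgAut_apply, Matrix.star_eq_conjTranspose, Function.comp_def] using this
  set G : Matrix q q ℝ := U * Matrix.diagonal (fun i => (d i)⁻¹) * Uᵀ with hGp
  have key : ∀ a b : q → ℝ, (U * Matrix.diagonal a * Uᵀ) * (U * Matrix.diagonal b * Uᵀ)
      = U * Matrix.diagonal (fun i => a i * b i) * Uᵀ := by
    intro a b
    calc _ = U * Matrix.diagonal a * (Uᵀ * U) * Matrix.diagonal b * Uᵀ := by
          simp only [Matrix.mul_assoc]
      _ = _ := by
          rw [hUU, Matrix.mul_one, Matrix.mul_assoc U, Matrix.diagonal_mul_diagonal]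
  have sym : ∀ a : q → ℝ, (U * Matrix.diagonal a * Uᵀ)ᵀ = U * Matrix.diagonal a * Uᵀ := by
    intro a
    simp [Matrix.transpose_mul, Matrix.mul_assoc]
  have hGX : G * (Xᵀ * X) = U * Matrix.diagonal (fun i => (d i)⁻¹ * d i) * Uᵀ := by
    rw [hGe, hGp, key]
  have hXGX : X * (G * (Xᵀ * X)) = X := by
    have h0 : Xᵀ * X * (G * (Xᵀ * X)) = Xᵀ * X := by
      rw [hGX, hGe, key]
      congr 3
      funext i
      by_cases h : d i = 0 <;> simp [h]
    have h1 : (X * (G * (Xᵀ * X)) - X)ᵀ * (X * (G * (Xᵀ * X)) - X) = 0 := by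
      have h2 : Xᵀ * (X * (G * (Xᵀ * X)) - X) = 0 := by
        rw [Matrix.mul_sub, ← Matrix.mul_assoc, h0, sub_self]
      rw [Matrix.transpose_sub, Matrix.transpose_mul, Matrix.sub_mul, Matrix.mul_assoc, h2]
      simp
    have h3 := Matrix.conjTranspose_mul_self_eq_zero.mp
      (show (X * (G * (Xᵀ * X)) - X)ᴴ * (X * (G * (Xᵀ * X)) - X) = 0 by simpa using h1)
    exact sub_eq_zero.mp h3
  refine ⟨G * Xᵀ, ?_, ?_, ?_, ?_⟩
  · simpa only [Matrix.mul_assoc] using hXGX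
  · have : G * (Xᵀ * X) * G = G := by
      rw [hGX, hGp, key]
      congr 3
      funext i
      by_cases h : d i = 0 <;> simp [h]
    calc G * Xᵀ * X * (G * Xᵀ) = (G * (Xᵀ * X) * G) * Xᵀ := by simp only [Matrix.mul_assoc]
      _ = _ := by rw [this]
  · have : Gᵀ = G := sym _
    simp [Matrix.transpose_mul, this, Matrix.mul_assoc]
  · rw [Matrix.mul_assoc, hGX, sym]

/-- The Moore–Penrose pseudoinverse `X†`. -/
noncomputable def pinv {p q : Type*} [Fintype p] [Fintype q] (X : Matrix p q ℝ) :
    Matrix q p ℝ :=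
  Classical.choose (exists_isMoorePenrose X)

theorem pinv_spec {p q : Type*} [Fintype p] [Fintype q] (X : Matrix p q ℝ) :
    IsMoorePenrose X (pinv X) :=
  Classical.choose_spec (exists_isMoorePenrose X)

/-- The four Penrose equations determine the pseudoinverse. -/
theorem IsMoorePenrose.unique {p q : Type*} [Fintype p] [Fintype q] {X : Matrix p q ℝ}
    {Y Z : Matrix q p ℝ} (hY : IsMoorePenrose X Y) (hZ : IsMoorePenrose X Z) : Y = Z := by
  have h1 : X * Y = X * Z := by
    calc X * Y = (X * Y)ᵀ := hY.symm_left.symm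
      _ = (X * Z * (X * Y))ᵀ := by rw [← Matrix.mul_assoc, hZ.mul_mul_left]
      _ = X * Y * (X * Z) := by rw [Matrix.transpose_mul, hY.symm_left, hZ.symm_left]
      _ = X * Z := by rw [← Matrix.mul_assoc, hY.mul_mul_left]
  have h2 : Y * X = Z * X := by
    calc Y * X = (Y * X)ᵀ := hY.symm_right.symm
      _ = (Y * X * (Z * X))ᵀ := by
          rw [Matrix.mul_assoc, ← Matrix.mul_assoc X, hZ.mul_mul_left]
      _ = Z * X * (Y * X) := by rw [Matrix.transpose_mul, hY.symm_right, hZ.symm_right]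
      _ = Z * X := by rw [Matrix.mul_assoc, ← Matrix.mul_assoc X, hY.mul_mul_left]
  calc Y = Y * X * Y := hY.mul_mul_right.symm
    _ = Z * (X * Y) := by rw [h2, Matrix.mul_assoc]
    _ = Z * X * Z := by rw [h1, Matrix.mul_assoc]
    _ = Z := hZ.mul_mul_right

/-! ### The system `x(t+1) = A x(t) + B u(t)`, `y(t) = C x(t)` -/

/-- `F_u = [A^{n-1} B, …, A B, B]`; the first component of a column index is the block index. -/
def ctrbMatrix {n m : ℕ} (A : Matrix (Fin n) (Fin n) ℝ) (B : Matrix (Fin n) (Fin m) ℝ) :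
    Matrix (Fin n) (Fin n × Fin m) ℝ :=
  Matrix.of fun i j => (A ^ (n - 1 - (j.1 : ℕ)) * B) i j.2

/-- The observability matrix, with block rows `C, C A, …, C A^{n-1}`. -/
def obsvMatrix {n l : ℕ} (A : Matrix (Fin n) (Fin n) ℝ) (C : Matrix (Fin l) (Fin n) ℝ) :
    Matrix (Fin n × Fin l) (Fin n) ℝ :=
  Matrix.of fun i j => (C * A ^ (i.1 : ℕ)) i.2 j

/-- `(A, B)` is controllable: `[A^{n-1} B, …, A B, B]` has rank `n`. -/
def IsControllable {n m : ℕ} (A : Matrix (Fin n) (Fin n) ℝ) (B : Matrix (Fin n) (Fin m) ℝ) :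
    Prop :=
  (ctrbMatrix A B).rank = n

/-- `(A, C)` is observable: the observability matrix has rank `n`. -/
def IsObservable {n l : ℕ} (A : Matrix (Fin n) (Fin n) ℝ) (C : Matrix (Fin l) (Fin n) ℝ) :
    Prop :=
  (obsvMatrix A C).rank = n

/-- The impulse response `M(k) = C A^{k-1} B` (used for `k ≥ 1` only). -/
def markov {n m l : ℕ} (A : Matrix (Fin n) (Fin n) ℝ) (B : Matrix (Fin n) (Fin m) ℝ)
    (C : Matrix (Fin l) (Fin n) ℝ) (k : ℕ) : Matrix (Fin l) (Fin m) ℝ :=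
  C * A ^ (k - 1) * B

/-- The block lower triangular Toeplitz matrix with `N` block rows and columns: zero blocks on and
above the diagonal and `M(i - j)` in block position `(i, j)`, `i > j`. The matrix `S_t` for the
horizon `T` has `N = T - t + 1` blocks, so that `S_{T-n+1}` has `N = n` blocks for every `T`. -/
def toeplitzS {n m l : ℕ} (A : Matrix (Fin n) (Fin n) ℝ) (B : Matrix (Fin n) (Fin m) ℝ)
    (C : Matrix (Fin l) (Fin n) ℝ) (N : ℕ) : Matrix (Fin N × Fin l) (Fin N × Fin m) ℝ :=
  Matrix.of fun i j =>
    if j.1 < i.1 then markov A B C ((i.1 : ℕ) - (j.1 : ℕ)) i.2 j.2 else 0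

/-- The matrix `[F_u - A^n O† S_{T-n+1}, A^n O†]`, acting on the stacked past inputs and
outputs `(U_n(t), Y_n(t))`. -/
noncomputable def windowMatrix {n m l : ℕ} (A : Matrix (Fin n) (Fin n) ℝ)
    (B : Matrix (Fin n) (Fin m) ℝ) (C : Matrix (Fin l) (Fin n) ℝ) :
    Matrix (Fin n) ((Fin n × Fin m) ⊕ (Fin n × Fin l)) ℝ :=
  Matrix.fromCols
    (ctrbMatrix A B - A ^ n * pinv (obsvMatrix A C) * toeplitzS A B C n)
    (A ^ n * pinv (obsvMatrix A C))

/-! ### Riccati recursion and gains -/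

/-- The right-hand side of the Riccati equation,
`AᵀPA - AᵀPB (R + BᵀPB)⁻¹ BᵀPA + CᵀQC`. -/
noncomputable def riccatiMap {n m l : ℕ} (A : Matrix (Fin n) (Fin n) ℝ)
    (B : Matrix (Fin n) (Fin m) ℝ) (C : Matrix (Fin l) (Fin n) ℝ)
    (Q : Matrix (Fin l) (Fin l) ℝ) (R : Matrix (Fin m) (Fin m) ℝ)
    (P : Matrix (Fin n) (Fin n) ℝ) : Matrix (Fin n) (Fin n) ℝ :=
  Aᵀ * P * A - Aᵀ * P * B * (R + Bᵀ * P * B)⁻¹ * Bᵀ * P * A + Cᵀ * Q * C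

/-- The state feedback gain `(R + BᵀPB)⁻¹ BᵀPA` belonging to `P`. -/
noncomputable def feedbackGain {n m : ℕ} (A : Matrix (Fin n) (Fin n) ℝ)
    (B : Matrix (Fin n) (Fin m) ℝ) (R : Matrix (Fin m) (Fin m) ℝ)
    (P : Matrix (Fin n) (Fin n) ℝ) : Matrix (Fin m) (Fin n) ℝ :=
  (R + Bᵀ * P * B)⁻¹ * Bᵀ * P * A

/-- The solution `P_t` (`0 ≤ t ≤ T`) of the backward Riccati recursion with `P_T = CᵀQC`. -/
noncomputable def riccatiP {n m l : ℕ} (A : Matrix (Fin n) (Fin n) ℝ)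
    (B : Matrix (Fin n) (Fin m) ℝ) (C : Matrix (Fin l) (Fin n) ℝ)
    (Q : Matrix (Fin l) (Fin l) ℝ) (R : Matrix (Fin m) (Fin m) ℝ) (T t : ℕ) :
    Matrix (Fin n) (Fin n) ℝ :=
  (riccatiMap A B C Q R)^[T - t] (Cᵀ * Q * C)

theorem riccatiP_terminal {n m l : ℕ} (A : Matrix (Fin n) (Fin n) ℝ)
    (B : Matrix (Fin n) (Fin m) ℝ) (C : Matrix (Fin l) (Fin n) ℝ)
    (Q : Matrix (Fin l) (Fin l) ℝ) (R : Matrix (Fin m) (Fin m) ℝ) (T : ℕ) :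
    riccatiP A B C Q R T T = Cᵀ * Q * C := by
  simp [riccatiP]

theorem riccatiP_step {n m l : ℕ} (A : Matrix (Fin n) (Fin n) ℝ)
    (B : Matrix (Fin n) (Fin m) ℝ) (C : Matrix (Fin l) (Fin n) ℝ)
    (Q : Matrix (Fin l) (Fin l) ℝ) (R : Matrix (Fin m) (Fin m) ℝ) {T t : ℕ} (h : t < T) :
    riccatiP A B C Q R T t = riccatiMap A B C Q R (riccatiP A B C Q R T (t + 1)) := by
  have : T - t = (T - (t + 1)) + 1 := by omega
  rw [riccatiP, this, Function.iterate_succ_apply', riccatiP]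

/-- `P` is a positive definite solution of the discrete-time algebraic Riccati equation. -/
def IsPosDefDARESolution {n m l : ℕ} (A : Matrix (Fin n) (Fin n) ℝ)
    (B : Matrix (Fin n) (Fin m) ℝ) (C : Matrix (Fin l) (Fin n) ℝ)
    (Q : Matrix (Fin l) (Fin l) ℝ) (R : Matrix (Fin m) (Fin m) ℝ)
    (P : Matrix (Fin n) (Fin n) ℝ) : Prop :=
  P.PosDef ∧ P = riccatiMap A B C Q R P

/-- The gain `K_LQR^t = K_t [F_u - A^n O† S_{T-n+1}, A^n O†]` for the horizon `T`, with
`K_t = (R + BᵀP_{t+1}B)⁻¹ BᵀP_{t+1}A` (`0 ≤ t ≤ T - 1`). -/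
noncomputable def gainLQR {n m l : ℕ} (A : Matrix (Fin n) (Fin n) ℝ)
    (B : Matrix (Fin n) (Fin m) ℝ) (C : Matrix (Fin l) (Fin n) ℝ)
    (Q : Matrix (Fin l) (Fin l) ℝ) (R : Matrix (Fin m) (Fin m) ℝ) (T t : ℕ) :
    Matrix (Fin m) ((Fin n × Fin m) ⊕ (Fin n × Fin l)) ℝ :=
  feedbackGain A B R (riccatiP A B C Q R T (t + 1)) * windowMatrix A B C

/-- The stationary gain `K_LQR^* = K^* [F_u - A^n O† S_{T-n+1}, A^n O†]`, with
`K^* = (R + BᵀP^*B)⁻¹ BᵀP^*A`, belonging to `P^* = Pstar`. -/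
noncomputable def gainLQRStar {n m l : ℕ} (A : Matrix (Fin n) (Fin n) ℝ)
    (B : Matrix (Fin n) (Fin m) ℝ) (C : Matrix (Fin l) (Fin n) ℝ)
    (R : Matrix (Fin m) (Fin m) ℝ) (Pstar : Matrix (Fin n) (Fin n) ℝ) :
    Matrix (Fin m) ((Fin n × Fin m) ⊕ (Fin n × Fin l)) ℝ :=
  feedbackGain A B R Pstar * windowMatrix A B C

end LQR

/-!
Write `ℛ` for the Riccati map and `K` for the feedback gain. The iterates of `ℛ` started at `CᵀQC`
increase in the Loewner order, and they are bounded because controllability lets every initial state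
be steered to `0` in `n` steps at a cost that does not depend on the horizon. Hence they converge to
a positive semidefinite fixed point `P`.

For a positive semidefinite fixed point `P` with closed loop `F = A - B K(P)`, the difference
`P - Fᵀ P F` is the one-step cost. Its sum over `n` steps is positive definite by observability of
`(A, QC)`, which makes `P` positive definite and `F ^ k = O(μ ^ k)` for some `μ < 1`.

The rate comes from the identity `ℛ(P) - ℛ(X) = Fᵀ (P - X) G`, where `G` is the closed loop of `X`.
Iterating it gives `P - ℛ^k(X) = (F ^ k)ᵀ (P - X) Φ_k` with `Φ_kᵀ X Φ_k ≤ ℛ^k(X)`. For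
`X > 0` with bounded iterates the products `Φ_k` are bounded, so the error is `O(μ ^ k)`; with `X`
another fixed point this also gives uniqueness.
-/

namespace LQR

open Filter Topology Asymptotics
open scoped MatrixOrder

section Loewner

open scoped ComplexOrder

variable {𝕜 p : Type*} [RCLike 𝕜]

theorem posDef_of_le {M N : Matrix p p 𝕜} (hM : M.PosDef) (h : M ≤ N) : N.PosDef := by
  simpa using hM.add_posSemidef (Matrix.le_iff.mp h)

theorem posDef_of_forall_mulVec_eq_zero [Fintype p] {M : Matrix p p 𝕜} (hM : M.PosSemidef)
    (h : ∀ x, M *ᵥ x = 0 → x = 0) : M.PosDef := by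
  classical
  refine hM.posDef_iff_isUnit.mpr (Matrix.mulVec_injective_iff_isUnit.mp fun x y hxy => ?_)
  exact sub_eq_zero.mp (h _ (by rw [Matrix.mulVec_sub, hxy, sub_self]))

theorem mulVec_eq_zero_of_add_mulVec_eq_zero [Fintype p] {M N : Matrix p p 𝕜} (hM : M.PosSemidef)
    (hN : N.PosSemidef) {x : p → 𝕜} (h : (M + N) *ᵥ x = 0) : M *ᵥ x = 0 ∧ N *ᵥ x = 0 := by
  have hsum : star x ⬝ᵥ M *ᵥ x + star x ⬝ᵥ N *ᵥ x = 0 := by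
    rw [← dotProduct_add, ← Matrix.add_mulVec, h, dotProduct_zero]
  obtain ⟨hMx, hNx⟩ := (add_eq_zero_iff_of_nonneg (hM.dotProduct_mulVec_nonneg x)
    (hN.dotProduct_mulVec_nonneg x)).mp hsum
  exact ⟨(hM.dotProduct_mulVec_zero_iff x).mp hMx, (hN.dotProduct_mulVec_zero_iff x).mp hNx⟩

theorem isClosed_setOf_posSemidef [Finite p] : IsClosed {M : Matrix p p 𝕜 | M.PosSemidef} := by
  have := Fintype.ofFinite p
  simp only [Matrix.posSemidef_iff_dotProduct_mulVec, Set.ofPred_and, Set.ofPred_forall]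
  refine (isClosed_eq continuous_id.matrix_conjTranspose continuous_id).inter
    (isClosed_iInter fun x => isClosed_le continuous_const ?_)
  exact continuous_const.dotProduct (continuous_id.matrix_mulVec continuous_const)

theorem exists_pos_smul_one_le [Finite p] [DecidableEq p] {M : Matrix p p 𝕜} (hM : M.PosDef) :
    ∃ ε : ℝ, 0 < ε ∧ ε • (1 : Matrix p p 𝕜) ≤ M := by
  have := Fintype.ofFinite p
  rcases subsingleton_or_nontrivial (Matrix p p 𝕜) with h | h
  · exact ⟨1, one_pos, (Subsingleton.elim _ _).le⟩
  · simpa only [gt_iff_lt, Algebra.algebraMap_eq_smul_one] using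
      (CFC.exists_pos_algebraMap_le_iff hM.isHermitian).2
        fun x hx => hM.isStrictlyPositive.spectrum_pos hx

end Loewner

section Congruence

variable {p q : Type*} [Fintype p]

theorem posSemidef_transpose_mul_mul [Finite q] {M : Matrix p p ℝ} (hM : M.PosSemidef)
    (Z : Matrix p q ℝ) : (Zᵀ * M * Z).PosSemidef := by
  have := Fintype.ofFinite q
  simpa using hM.conjTranspose_mul_mul_same Z

theorem transpose_mul_mul_mono [Finite q] {M N : Matrix p p ℝ} (h : M ≤ N) (Z : Matrix p q ℝ) :
    Zᵀ * M * Z ≤ Zᵀ * N * Z := by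
  rw [Matrix.le_iff, ← Matrix.sub_mul, ← Matrix.mul_sub]
  exact posSemidef_transpose_mul_mul (Matrix.le_iff.mp h) Z

theorem mulVec_mulVec_eq_zero_of_transpose_mul_mul [Fintype q] {M : Matrix p p ℝ}
    (hM : M.PosSemidef) {Z : Matrix p q ℝ} {x : q → ℝ} (h : (Zᵀ * M * Z) *ᵥ x = 0) :
    M *ᵥ (Z *ᵥ x) = 0 := by
  refine (hM.dotProduct_mulVec_zero_iff _).mp ?_
  rw [star_trivial, Matrix.dotProduct_mulVec, Matrix.vecMul_mulVec, ← Matrix.dotProduct_mulVec,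
    Matrix.mulVec_mulVec, h, dotProduct_zero]

end Congruence

section Norm

variable {p : Type*} [Fintype p] [DecidableEq p]

theorem le_norm_smul_one {M : Matrix p p ℝ} (hM : M.IsHermitian) :
    M ≤ ‖M‖ • (1 : Matrix p p ℝ) := by
  rw [← Algebra.algebraMap_eq_smul_one, le_algebraMap_iff_spectrum_le hM.isSelfAdjoint]
  intro x hx
  calc x ≤ ‖id x‖ := Real.le_norm_self x
    _ ≤ ‖cfc id M‖ := norm_apply_le_norm_cfc id M hx
    _ = ‖M‖ := by rw [cfc_id ℝ M]

theorem norm_le_of_forall_spectrum_le {M : Matrix p p ℝ} (hM : M.PosSemidef) {r : ℝ} (hr : 0 ≤ r)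
    (h : ∀ x ∈ spectrum ℝ M, x ≤ r) : ‖M‖ ≤ r := by
  rw [← cfc_id ℝ M hM.isHermitian.isSelfAdjoint]
  exact norm_cfc_le hr fun x hx =>
    (Real.norm_of_nonneg (spectrum_nonneg_of_nonneg hM.nonneg hx)).trans_le (h x hx)

theorem norm_le_norm_of_le {M N : Matrix p p ℝ} (hM : M.PosSemidef) (h : M ≤ N) :
    ‖M‖ ≤ ‖N‖ := by
  have hN : N.IsHermitian := (Matrix.nonneg_iff_posSemidef.mp (hM.nonneg.trans h)).isHermitian
  refine norm_le_of_forall_spectrum_le hM (norm_nonneg N) ?_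
  rw [← le_algebraMap_iff_spectrum_le hM.isHermitian.isSelfAdjoint, Algebra.algebraMap_eq_smul_one]
  exact h.trans (le_norm_smul_one hN)

theorem norm_le_trace {M : Matrix p p ℝ} (hM : M.PosSemidef) : ‖M‖ ≤ M.trace := by
  have hnonneg : ∀ i, 0 ≤ hM.isHermitian.eigenvalues i := hM.eigenvalues_nonneg
  rw [hM.isHermitian.trace_eq_sum_eigenvalues]
  refine norm_le_of_forall_spectrum_le hM (Finset.sum_nonneg fun i _ => hnonneg i) ?_
  rw [hM.isHermitian.spectrum_real_eq_range_eigenvalues]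
  rintro _ ⟨i, rfl⟩
  exact Finset.single_le_sum (fun j _ => hnonneg j) (Finset.mem_univ i)

theorem exists_norm_sq_le_mul_norm {Y : Matrix p p ℝ} (hY : Y.PosDef) :
    ∃ c : ℝ, 0 < c ∧ ∀ Φ : Matrix p p ℝ, ‖Φ‖ ^ 2 ≤ c * ‖Φᵀ * Y * Φ‖ := by
  obtain ⟨ε, hε, hεY⟩ := exists_pos_smul_one_le hY
  refine ⟨ε⁻¹, inv_pos.mpr hε, fun Φ => ?_⟩
  have hΦ : Φᵀ * (ε • (1 : Matrix p p ℝ)) * Φ = ε • (Φᵀ * Φ) := by simp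
  rw [le_inv_mul_iff₀ hε]
  calc ε * ‖Φ‖ ^ 2 = ‖Φᵀ * (ε • (1 : Matrix p p ℝ)) * Φ‖ := by
        rw [hΦ, norm_smul, Real.norm_of_nonneg hε.le,
          ← Matrix.conjTranspose_eq_transpose_of_trivial,
          Matrix.l2_opNorm_conjTranspose_mul_self, sq]
    _ ≤ ‖Φᵀ * Y * Φ‖ := by
        refine norm_le_norm_of_le ?_ (transpose_mul_mul_mono hεY Φ)
        rw [hΦ]
        exact (Matrix.posSemidef_conjTranspose_mul_self Φ).smul hε.le

end Norm

theorem isBigO_matrix_mul {p q r ι : Type*} [Fintype p] [Fintype q] [Fintype r] [DecidableEq q]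
    [DecidableEq r] {u : Filter ι} {M : ι → Matrix p q ℝ} {N : ι → Matrix q r ℝ} {f g : ι → ℝ}
    (hM : M =O[u] f) (hN : N =O[u] g) : (fun i => M i * N i) =O[u] fun i => f i * g i := by
  refine IsBigO.trans (IsBigO.of_norm_le fun i => ?_) (hM.norm_left.mul hN.norm_left)
  exact Matrix.l2_opNorm_mul (M i) (N i)

theorem isBigO_pow_of_shift {E : Type*} [NormedAddCommGroup E] {f : ℕ → E} {μ : ℝ} (hμ : μ ≠ 0)
    (N : ℕ) (h : (fun k => f (k + N)) =O[atTop] fun k => μ ^ k) : f =O[atTop] fun k => μ ^ k := by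
  rw [← map_add_atTop_eq_nat N, isBigO_map]
  refine h.trans ((isBigO_const_mul_self (μ ^ N)⁻¹ (fun k => μ ^ (k + N)) atTop).congr_left ?_)
  intro k
  rw [pow_add, mul_comm (μ ^ k), inv_mul_cancel_left₀ (pow_ne_zero N hμ)]

section Convergence

variable {p : Type*} [Finite p]

/- The trace dominates the norm on differences, so the sequence is Cauchy because its traces are. -/
theorem exists_tendsto_of_monotone {ι : Type*} [SemilatticeSup ι] [Nonempty ι]
    {X : ι → Matrix p p ℝ} (hmono : Monotone X) (hbdd : BddAbove (Set.range X)) :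
    ∃ P, Tendsto X atTop (𝓝 P) := by
  classical
  have := Fintype.ofFinite p
  have hnorm {M N : Matrix p p ℝ} (h : M ≤ N) : ‖N - M‖ ≤ N.trace - M.trace := by
    simpa only [Matrix.trace_sub] using norm_le_trace (Matrix.le_iff.mp h)
  have htrace : Monotone fun k => (X k).trace := fun i j hij =>
    sub_nonneg.mp ((norm_nonneg _).trans (hnorm (hmono hij)))
  have htrace_bdd : BddAbove (Set.range fun k => (X k).trace) := by
    obtain ⟨Y, hY⟩ := hbdd
    refine ⟨Y.trace, Set.forall_mem_range.mpr fun k => ?_⟩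
    exact sub_nonneg.mp ((norm_nonneg _).trans (hnorm (hY (Set.mem_range_self k))))
  refine cauchySeq_tendsto_of_complete (Metric.cauchySeq_iff'.mpr fun ε hε => ?_)
  obtain ⟨N, hN⟩ :=
    Metric.cauchySeq_iff'.mp (tendsto_atTop_ciSup htrace htrace_bdd).cauchySeq ε hε
  refine ⟨N, fun k hk => ?_⟩
  rw [dist_eq_norm]
  exact (hnorm (hmono hk)).trans_lt ((le_abs_self _).trans_lt (hN k hk))

theorem eventually_posDef_of_tendsto {ι : Type*} {u : Filter ι} {X : ι → Matrix p p ℝ}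
    {P : Matrix p p ℝ} (hX : ∀ k, (X k).IsHermitian) (hP : P.PosDef) (hlim : Tendsto X u (𝓝 P)) :
    ∀ᶠ k in u, (X k).PosDef := by
  classical
  have := Fintype.ofFinite p
  obtain ⟨ε, hε, hεP⟩ := exists_pos_smul_one_le hP
  filter_upwards [hlim.eventually (Metric.ball_mem_nhds P hε)] with k hk
  rw [dist_comm, dist_eq_norm] at hk
  refine posDef_of_le (Matrix.PosDef.one.smul (sub_pos.mpr hk)) ?_
  calc (ε - ‖P - X k‖) • (1 : Matrix p p ℝ)
      = ε • 1 - ‖P - X k‖ • 1 := sub_smul _ _ _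
    _ ≤ P - (P - X k) := sub_le_sub hεP (le_norm_smul_one (hP.isHermitian.sub (hX k)))
    _ = X k := sub_sub_cancel _ _

theorem exists_le_smul_of_posDef_sub {S M : Matrix p p ℝ} (hS : S.IsHermitian)
    (h : (S - M).PosDef) : ∃ ρ ∈ Set.Ioo (0 : ℝ) 1, M ≤ ρ • S := by
  classical
  have := Fintype.ofFinite p
  obtain ⟨ε, hε, hεS⟩ := exists_pos_smul_one_le h
  set s := ‖S‖ + 2 * ε
  have hs_pos : 0 < s := by positivity
  have hεs : ε / s < 1 := by rw [div_lt_one hs_pos]; linarith [norm_nonneg S]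
  refine ⟨1 - ε / s, ⟨by linarith, by linarith [div_pos hε hs_pos]⟩, ?_⟩
  have hSs : (ε / s) • S ≤ ε • (1 : Matrix p p ℝ) :=
    calc (ε / s) • S ≤ (ε / s) • (s • (1 : Matrix p p ℝ)) := by
          refine smul_le_smul_of_nonneg_left ((le_norm_smul_one hS).trans ?_) (by positivity)
          exact smul_le_smul_of_nonneg_right (by linarith) Matrix.PosSemidef.one.nonneg
      _ = ε • 1 := by rw [smul_smul, div_mul_cancel₀ _ hs_pos.ne']
  calc M = S - (S - M) := (sub_sub_cancel S M).symm
    _ ≤ S - (ε / s) • S := sub_le_sub_left (hSs.trans hεS) S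
    _ = (1 - ε / s) • S := by rw [sub_smul, one_smul]

end Convergence

section Stability

variable {p : Type*} [Fintype p] [DecidableEq p]

theorem pow_conj_le_smul_of_conj_le_smul {S F : Matrix p p ℝ} {ρ : ℝ} (hρ : 0 ≤ ρ)
    (h : Fᵀ * S * F ≤ ρ • S) (k : ℕ) : (F ^ k)ᵀ * S * F ^ k ≤ ρ ^ k • S := by
  induction k with
  | zero => simp
  | succ k ih =>
    calc (F ^ (k + 1))ᵀ * S * F ^ (k + 1) = Fᵀ * ((F ^ k)ᵀ * S * F ^ k) * F := by
          simp only [pow_succ, Matrix.transpose_mul, Matrix.mul_assoc]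
      _ ≤ Fᵀ * (ρ ^ k • S) * F := transpose_mul_mul_mono ih F
      _ = ρ ^ k • (Fᵀ * S * F) := by simp
      _ ≤ ρ ^ k • (ρ • S) := smul_le_smul_of_nonneg_left h (by positivity)
      _ = ρ ^ (k + 1) • S := by rw [smul_smul, pow_succ]

theorem exists_isBigO_pow_of_posDef_sub_conj {S F : Matrix p p ℝ} (hS : S.PosDef)
    (hF : (S - Fᵀ * S * F).PosDef) :
    ∃ μ ∈ Set.Ioo (0 : ℝ) 1, (fun k : ℕ => F ^ k) =O[atTop] fun k => μ ^ k := by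
  obtain ⟨ρ, hρ, hFS⟩ := exists_le_smul_of_posDef_sub hS.isHermitian hF
  obtain ⟨c, hc, hnorm⟩ := exists_norm_sq_le_mul_norm hS
  have hsq (k : ℕ) : ‖F ^ k‖ ^ 2 ≤ c * ‖S‖ * (√ρ ^ k) ^ 2 :=
    calc ‖F ^ k‖ ^ 2 ≤ c * ‖(F ^ k)ᵀ * S * F ^ k‖ := hnorm _
      _ ≤ c * ‖ρ ^ k • S‖ := by
          gcongr
          exact norm_le_norm_of_le (posSemidef_transpose_mul_mul hS.posSemidef _)
            (pow_conj_le_smul_of_conj_le_smul hρ.1.le hFS k)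
      _ = c * ‖S‖ * (√ρ ^ k) ^ 2 := by
          rw [norm_smul, Real.norm_of_nonneg (pow_nonneg hρ.1.le k), pow_right_comm,
            Real.sq_sqrt hρ.1.le]
          ring
  refine ⟨√ρ, ⟨Real.sqrt_pos.mpr hρ.1, ?_⟩, IsBigO.of_bound √(c * ‖S‖) (.of_forall fun k => ?_)⟩
  · rw [Real.sqrt_lt' one_pos, one_pow]
    exact hρ.2
  · rw [Real.norm_of_nonneg (by positivity)]
    refine le_of_sq_le_sq ?_ (by positivity)
    rw [mul_pow, Real.sq_sqrt (by positivity)]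
    exact hsq k

/-- The finite observability Gramian `∑_{j < N} (F^j)ᵀ V F^j` of the dynamics `x ↦ F x` with output
weight `V`: the cost accumulated along `N` steps from `x` is `xᵀ (gramian F V N) x`. -/
def gramian (F V : Matrix p p ℝ) (N : ℕ) : Matrix p p ℝ :=
  ∑ j ∈ Finset.range N, (F ^ j)ᵀ * V * F ^ j

theorem gramian_posSemidef {V : Matrix p p ℝ} (hV : V.PosSemidef) (F : Matrix p p ℝ) (N : ℕ) :
    (gramian F V N).PosSemidef :=
  Matrix.posSemidef_sum _ fun j _ => posSemidef_transpose_mul_mul hV (F ^ j)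

theorem gramian_mono {V W : Matrix p p ℝ} (h : V ≤ W) (F : Matrix p p ℝ) (N : ℕ) :
    gramian F V N ≤ gramian F W N :=
  Finset.sum_le_sum fun j _ => transpose_mul_mul_mono h (F ^ j)

theorem gramian_sub_transpose_mul_mul (F M : Matrix p p ℝ) (N : ℕ) :
    gramian F (M - Fᵀ * M * F) N = M - (F ^ N)ᵀ * M * F ^ N := by
  calc gramian F (M - Fᵀ * M * F) N
      = ∑ j ∈ Finset.range N,
          ((F ^ j)ᵀ * M * F ^ j - (F ^ (j + 1))ᵀ * M * F ^ (j + 1)) := by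
        refine Finset.sum_congr rfl fun j _ => ?_
        rw [Matrix.mul_sub, Matrix.sub_mul, pow_succ', Matrix.transpose_mul]
        simp only [Matrix.mul_assoc]
    _ = M - (F ^ N)ᵀ * M * F ^ N := by
        rw [Finset.sum_range_sub', pow_zero, Matrix.transpose_one, Matrix.one_mul, Matrix.mul_one]

theorem transpose_mul_gramian_mul (F M : Matrix p p ℝ) (N : ℕ) :
    Fᵀ * gramian F M N * F = gramian F (Fᵀ * M * F) N := by
  simp only [gramian, Matrix.mul_sum, Matrix.sum_mul]
  refine Finset.sum_congr rfl fun j _ => ?_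
  calc Fᵀ * ((F ^ j)ᵀ * M * F ^ j) * F = (F ^ j * F)ᵀ * M * (F ^ j * F) := by
        simp only [Matrix.transpose_mul, Matrix.mul_assoc]
    _ = (F ^ j)ᵀ * (Fᵀ * M * F) * F ^ j := by
        rw [pow_mul_comm' F j]
        simp only [Matrix.transpose_mul, Matrix.mul_assoc]

theorem gramian_sub (F V W : Matrix p p ℝ) (N : ℕ) :
    gramian F (V - W) N = gramian F V N - gramian F W N := by
  simp only [gramian, Matrix.mul_sub, Matrix.sub_mul, Finset.sum_sub_distrib]

theorem mulVec_pow_mulVec_eq_zero_of_gramian {F V : Matrix p p ℝ} (hV : V.PosSemidef) {N : ℕ}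
    {x : p → ℝ} (h : gramian F V N *ᵥ x = 0) {j : ℕ} (hj : j < N) : V *ᵥ (F ^ j *ᵥ x) = 0 := by
  induction N with
  | zero => exact absurd hj (Nat.not_lt_zero j)
  | succ N ih =>
    rw [gramian, Finset.sum_range_succ] at h
    obtain ⟨hinit, hlast⟩ := mulVec_eq_zero_of_add_mulVec_eq_zero (gramian_posSemidef hV F N)
      (posSemidef_transpose_mul_mul hV (F ^ N)) h
    rcases Nat.lt_succ_iff_lt_or_eq.mp hj with hj | rfl
    · exact ih hinit hj
    · exact mulVec_mulVec_eq_zero_of_transpose_mul_mul hV hlast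

theorem posDef_of_gramian_posDef {P F : Matrix p p ℝ} (hP : P.PosSemidef) {N : ℕ}
    (hW : (gramian F (P - Fᵀ * P * F) N).PosDef) : P.PosDef := by
  refine posDef_of_le hW ?_
  rw [gramian_sub_transpose_mul_mul]
  exact sub_le_self _ (posSemidef_transpose_mul_mul hP _).nonneg

/- `P` itself need not decrease strictly along `F` in one step; its sum over `N` steps does. -/
theorem exists_isBigO_pow_of_gramian_posDef {P F : Matrix p p ℝ} (hP : P.PosSemidef) {N : ℕ}
    (hW : (gramian F (P - Fᵀ * P * F) N).PosDef) :
    ∃ μ ∈ Set.Ioo (0 : ℝ) 1, (fun k : ℕ => F ^ k) =O[atTop] fun k => μ ^ k := by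
  have hle : P - Fᵀ * P * F ≤ P := sub_le_self _ (posSemidef_transpose_mul_mul hP F).nonneg
  refine exists_isBigO_pow_of_posDef_sub_conj (S := gramian F P N)
    (posDef_of_le hW (gramian_mono hle F N)) ?_
  rwa [transpose_mul_gramian_mul, ← gramian_sub]

end Stability

section Riccati

variable {n m l : ℕ} {A : Matrix (Fin n) (Fin n) ℝ} {B : Matrix (Fin n) (Fin m) ℝ}
  {C : Matrix (Fin l) (Fin n) ℝ} {Q : Matrix (Fin l) (Fin l) ℝ} {R : Matrix (Fin m) (Fin m) ℝ}
  {X Y : Matrix (Fin n) (Fin n) ℝ}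

/-- The closed-loop matrix `A - B K(X)` under the feedback gain belonging to `X`. -/
noncomputable def closedLoop (A : Matrix (Fin n) (Fin n) ℝ) (B : Matrix (Fin n) (Fin m) ℝ)
    (R : Matrix (Fin m) (Fin m) ℝ) (X : Matrix (Fin n) (Fin n) ℝ) : Matrix (Fin n) (Fin n) ℝ :=
  A - B * feedbackGain A B R X

/-- The weight of the quadratic cost `uᵀRu + (Cx)ᵀQ(Cx)` of a single step, as a function of the
state `z` for `u = U z` and `x = Z z`. -/
def stageCost {p : Type*} (C : Matrix (Fin l) (Fin n) ℝ) (Q : Matrix (Fin l) (Fin l) ℝ)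
    (R : Matrix (Fin m) (Fin m) ℝ) (Z : Matrix (Fin n) p ℝ) (U : Matrix (Fin m) p ℝ) :
    Matrix p p ℝ :=
  Uᵀ * R * U + Zᵀ * (Cᵀ * Q * C) * Z

theorem add_transpose_mul_mul_mul_feedbackGain (hX : IsUnit (R + Bᵀ * X * B)) :
    (R + Bᵀ * X * B) * feedbackGain A B R X = Bᵀ * X * A := by
  simp only [feedbackGain, Matrix.mul_assoc _ _ A, Matrix.mul_assoc _ Bᵀ]
  exact Matrix.mul_nonsing_inv_cancel_left _ _ ((Matrix.isUnit_iff_isUnit_det _).mp hX)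

theorem transpose_mul_mul_closedLoop (hX : IsUnit (R + Bᵀ * X * B)) :
    Bᵀ * X * closedLoop A B R X = R * feedbackGain A B R X := by
  rw [closedLoop, Matrix.mul_sub, ← add_transpose_mul_mul_mul_feedbackGain hX, Matrix.add_mul,
    ← Matrix.mul_assoc, add_sub_cancel_right]

theorem riccatiMap_eq_transpose_mul_mul_closedLoop :
    riccatiMap A B C Q R X = Aᵀ * X * closedLoop A B R X + Cᵀ * Q * C := by
  simp only [riccatiMap, closedLoop, feedbackGain, Matrix.mul_sub, Matrix.mul_assoc]

theorem riccatiMap_eq_closedLoop (hX : IsUnit (R + Bᵀ * X * B)) :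
    riccatiMap A B C Q R X = (closedLoop A B R X)ᵀ * X * closedLoop A B R X +
      stageCost C Q R 1 (feedbackGain A B R X) := by
  have hA : A = closedLoop A B R X + B * feedbackGain A B R X := (sub_add_cancel _ _).symm
  have hcross := transpose_mul_mul_closedLoop (A := A) hX
  rw [riccatiMap_eq_transpose_mul_mul_closedLoop, stageCost, Matrix.transpose_one, Matrix.one_mul,
    Matrix.mul_one, ← add_assoc, Matrix.mul_assoc _ R, ← hcross]
  nth_rw 1 [hA]
  simp only [Matrix.transpose_add, Matrix.transpose_mul, Matrix.add_mul, Matrix.mul_assoc]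

/- Completion of the square around the optimal input `U = -K(X) Z`. In terms of the deviation
`W = U + K(X) Z` the successor state is `F Z + B W`, and the cross terms cancel because
`BᵀXF = RK`. -/
theorem bellman_eq {p : Type*} (hR : R.IsSymm) (hXsymm : X.IsSymm)
    (hX : IsUnit (R + Bᵀ * X * B)) (Z : Matrix (Fin n) p ℝ) (U : Matrix (Fin m) p ℝ) :
    (A * Z + B * U)ᵀ * X * (A * Z + B * U) + stageCost C Q R Z U =
      Zᵀ * riccatiMap A B C Q R X * Z +
        (U + feedbackGain A B R X * Z)ᵀ * (R + Bᵀ * X * B) * (U + feedbackGain A B R X * Z) := by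
  have hcross := transpose_mul_mul_closedLoop (A := A) hX
  have hcross' : (closedLoop A B R X)ᵀ * X * B = (feedbackGain A B R X)ᵀ * R := by
    simpa only [Matrix.transpose_mul, Matrix.transpose_transpose, hXsymm.eq, hR.eq,
      Matrix.mul_assoc] using congrArg Matrix.transpose hcross
  obtain ⟨W, rfl⟩ : ∃ W, U = W - feedbackGain A B R X * Z := ⟨_, (add_sub_cancel_right _ _).symm⟩
  have hnext : A * Z + B * (W - feedbackGain A B R X * Z) = closedLoop A B R X * Z + B * W := by
    rw [closedLoop, Matrix.mul_sub, Matrix.sub_mul, Matrix.mul_assoc]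
    abel
  rw [hnext, sub_add_cancel, riccatiMap_eq_closedLoop hX]
  have hWZ : Wᵀ * (Bᵀ * (X * (closedLoop A B R X * Z))) =
      Wᵀ * (R * (feedbackGain A B R X * Z)) := by
    simp only [← Matrix.mul_assoc, ← hcross]
  have hZW : Zᵀ * ((closedLoop A B R X)ᵀ * (X * (B * W))) =
      Zᵀ * ((feedbackGain A B R X)ᵀ * (R * W)) := by
    simp only [← Matrix.mul_assoc, ← hcross']
  simp only [stageCost, Matrix.transpose_add, Matrix.transpose_sub, Matrix.transpose_mul,
    Matrix.transpose_one, Matrix.one_mul, Matrix.mul_one, Matrix.mul_add, Matrix.add_mul,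
    Matrix.mul_sub, Matrix.sub_mul, Matrix.mul_assoc, hWZ, hZW]
  abel

theorem riccatiMap_sub_riccatiMap (hR : R.IsSymm) (hYsymm : Y.IsSymm)
    (hX : IsUnit (R + Bᵀ * X * B)) (hY : IsUnit (R + Bᵀ * Y * B)) :
    riccatiMap A B C Q R Y - riccatiMap A B C Q R X =
      (closedLoop A B R Y)ᵀ * (Y - X) * closedLoop A B R X := by
  set F := closedLoop A B R X
  set G := closedLoop A B R Y with hG
  set K := feedbackGain A B R X
  set L := feedbackGain A B R Y
  have hGYB : Gᵀ * Y * B = Lᵀ * R := by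
    simpa only [Matrix.transpose_mul, Matrix.transpose_transpose, hYsymm.eq, hR.eq,
      Matrix.mul_assoc] using congrArg Matrix.transpose (transpose_mul_mul_closedLoop (A := A) hY)
  have hYF : Gᵀ * Y * F = Gᵀ * Y * A - Lᵀ * R * K := by
    rw [← hGYB, Matrix.mul_assoc _ B, ← Matrix.mul_sub]; rfl
  have hXF : Gᵀ * X * F = Aᵀ * X * F - Lᵀ * R * K := by
    rw [Matrix.mul_assoc Lᵀ, ← transpose_mul_mul_closedLoop (A := A) hX, hG, closedLoop]
    simp only [Matrix.transpose_sub, Matrix.transpose_mul, Matrix.sub_mul, Matrix.mul_assoc]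
    rfl
  have hGYA : Gᵀ * Y * A = Aᵀ * Y * G := by
    have hA : A = G + B * L := (sub_add_cancel _ _).symm
    calc Gᵀ * Y * A = Gᵀ * Y * G + Lᵀ * R * L := by
          rw [hA, Matrix.mul_add, ← Matrix.mul_assoc _ B, hGYB]
      _ = Aᵀ * Y * G := by
          rw [hA, Matrix.transpose_add, Matrix.add_mul, Matrix.add_mul, Matrix.mul_assoc Lᵀ,
            ← transpose_mul_mul_closedLoop (A := A) hY]
          simp only [Matrix.transpose_mul, Matrix.mul_assoc]
          rfl
  rw [Matrix.mul_sub, Matrix.sub_mul, hYF, hXF, hGYA, sub_sub_sub_cancel_right,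
    riccatiMap_eq_transpose_mul_mul_closedLoop, riccatiMap_eq_transpose_mul_mul_closedLoop,
    add_sub_add_right_eq_sub]

theorem feedbackGain_sub_feedbackGain (hX : IsUnit (R + Bᵀ * X * B))
    (hY : IsUnit (R + Bᵀ * Y * B)) :
    feedbackGain A B R Y - feedbackGain A B R X =
      (R + Bᵀ * Y * B)⁻¹ * Bᵀ * ((Y - X) * closedLoop A B R X) := by
  have hmul : (R + Bᵀ * Y * B) * (feedbackGain A B R Y - feedbackGain A B R X) =
      Bᵀ * ((Y - X) * closedLoop A B R X) := by
    rw [Matrix.mul_sub, add_transpose_mul_mul_mul_feedbackGain hY, Matrix.add_mul, Matrix.sub_mul,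
      Matrix.mul_sub, ← Matrix.mul_assoc Bᵀ X, transpose_mul_mul_closedLoop hX, closedLoop]
    simp only [Matrix.mul_sub, Matrix.mul_assoc]
    abel
  rw [Matrix.mul_assoc, ← hmul,
    Matrix.nonsing_inv_mul_cancel_left _ _ ((Matrix.isUnit_iff_isUnit_det _).mp hY)]

theorem posDef_add_transpose_mul_mul (hR : R.PosDef) (hX : X.PosSemidef) :
    (R + Bᵀ * X * B).PosDef :=
  hR.add_posSemidef (posSemidef_transpose_mul_mul hX B)

theorem isUnit_add_transpose_mul_mul (hR : R.PosDef) (hX : X.PosSemidef) :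
    IsUnit (R + Bᵀ * X * B) :=
  (posDef_add_transpose_mul_mul hR hX).isUnit

theorem transpose_mul_riccatiMap_mul_le {p : Type*} [Finite p] (hR : R.PosDef)
    (hX : X.PosSemidef) (Z : Matrix (Fin n) p ℝ) (U : Matrix (Fin m) p ℝ) :
    Zᵀ * riccatiMap A B C Q R X * Z ≤
      (A * Z + B * U)ᵀ * X * (A * Z + B * U) + stageCost C Q R Z U := by
  rw [bellman_eq (Matrix.isHermitian_iff_isSymm.mp hR.isHermitian)
    (Matrix.isHermitian_iff_isSymm.mp hX.isHermitian) (isUnit_add_transpose_mul_mul hR hX)]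
  exact le_add_of_nonneg_right (posSemidef_transpose_mul_mul
    (posDef_add_transpose_mul_mul hR hX).posSemidef _).nonneg

theorem riccatiMap_mono (hR : R.PosDef) (hX : X.PosSemidef) (hY : Y.PosSemidef) (hXY : X ≤ Y) :
    riccatiMap A B C Q R X ≤ riccatiMap A B C Q R Y := by
  set K := feedbackGain A B R Y with hK
  have hnext : A * (1 : Matrix (Fin n) (Fin n) ℝ) + B * -K = closedLoop A B R Y := by
    rw [Matrix.mul_one, Matrix.mul_neg, ← sub_eq_add_neg, closedLoop]
  calc riccatiMap A B C Q R X
      = (1 : Matrix (Fin n) (Fin n) ℝ)ᵀ * riccatiMap A B C Q R X * 1 := by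
        rw [Matrix.transpose_one, Matrix.one_mul, Matrix.mul_one]
    _ ≤ (closedLoop A B R Y)ᵀ * X * closedLoop A B R Y + stageCost C Q R 1 (-K) := by
        rw [← hnext]
        exact transpose_mul_riccatiMap_mul_le hR hX 1 (-K)
    _ ≤ (closedLoop A B R Y)ᵀ * Y * closedLoop A B R Y + stageCost C Q R 1 (-K) := by
        gcongr
        exact transpose_mul_mul_mono hXY _
    _ = riccatiMap A B C Q R Y := by
        rw [riccatiMap_eq_closedLoop (isUnit_add_transpose_mul_mul hR hY), ← hK]
        simp only [stageCost, Matrix.transpose_neg, Matrix.neg_mul, Matrix.mul_neg, neg_neg]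

theorem stageCost_posSemidef {p : Type*} [Finite p] (hQ : Q.PosSemidef) (hR : R.PosSemidef)
    (Z : Matrix (Fin n) p ℝ) (U : Matrix (Fin m) p ℝ) : (stageCost C Q R Z U).PosSemidef :=
  (posSemidef_transpose_mul_mul hR U).add
    (posSemidef_transpose_mul_mul (posSemidef_transpose_mul_mul hQ C) Z)

theorem mulVec_eq_zero_of_stageCost_mulVec {p : Type*} [Fintype p] (hQ : Q.PosSemidef)
    (hR : R.PosDef) {Z : Matrix (Fin n) p ℝ} {U : Matrix (Fin m) p ℝ} {x : p → ℝ}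
    (h : stageCost C Q R Z U *ᵥ x = 0) : U *ᵥ x = 0 ∧ (Q * C) *ᵥ (Z *ᵥ x) = 0 := by
  have hC := posSemidef_transpose_mul_mul hQ C
  obtain ⟨hU, hZ⟩ := mulVec_eq_zero_of_add_mulVec_eq_zero
    (posSemidef_transpose_mul_mul hR.posSemidef U) (posSemidef_transpose_mul_mul hC Z) h
  constructor
  · refine Matrix.mulVec_injective_of_isUnit hR.isUnit ?_
    rw [mulVec_mulVec_eq_zero_of_transpose_mul_mul hR.posSemidef hU, Matrix.mulVec_zero]
  · rw [← Matrix.mulVec_mulVec]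
    exact mulVec_mulVec_eq_zero_of_transpose_mul_mul hQ
      (mulVec_mulVec_eq_zero_of_transpose_mul_mul hC hZ)

theorem closedLoop_mul_mul_le_riccatiMap (hQ : Q.PosSemidef) (hR : R.PosDef)
    (hX : X.PosSemidef) :
    (closedLoop A B R X)ᵀ * X * closedLoop A B R X ≤ riccatiMap A B C Q R X := by
  rw [riccatiMap_eq_closedLoop (isUnit_add_transpose_mul_mul hR hX)]
  exact le_add_of_nonneg_right (stageCost_posSemidef hQ hR.posSemidef _ _).nonneg

theorem le_riccatiMap (hR : R.PosDef) (hX : X.PosSemidef) :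
    Cᵀ * Q * C ≤ riccatiMap A B C Q R X := by
  rw [riccatiMap_eq_closedLoop (isUnit_add_transpose_mul_mul hR hX), stageCost,
    Matrix.transpose_one, Matrix.one_mul, Matrix.mul_one, ← add_assoc]
  exact le_add_of_nonneg_left ((posSemidef_transpose_mul_mul hX _).add
    (posSemidef_transpose_mul_mul hR.posSemidef _)).nonneg

theorem riccatiMap_posSemidef (hQ : Q.PosSemidef) (hR : R.PosDef) (hX : X.PosSemidef) :
    (riccatiMap A B C Q R X).PosSemidef :=
  Matrix.nonneg_iff_posSemidef.mp
    ((posSemidef_transpose_mul_mul hQ C).nonneg.trans (le_riccatiMap hR hX))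

theorem continuousAt_inv_add_transpose_mul_mul (hX : IsUnit (R + Bᵀ * X * B)) :
    ContinuousAt (fun Y => (R + Bᵀ * Y * B)⁻¹) X := by
  have hdet : (R + Bᵀ * X * B).det ≠ 0 := ((Matrix.isUnit_iff_isUnit_det _).mp hX).ne_zero
  have hdet_inv : ContinuousAt Ring.inverse (R + Bᵀ * X * B).det := by
    rw [Ring.inverse_eq_inv']
    exact continuousAt_inv₀ hdet
  have hsum : Continuous fun Y : Matrix (Fin n) (Fin n) ℝ => R + Bᵀ * Y * B := by fun_prop
  exact (continuousAt_matrix_inv _ hdet_inv).tendsto.comp (hsum.tendsto X)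

theorem continuousAt_riccatiMap (hX : IsUnit (R + Bᵀ * X * B)) :
    ContinuousAt (riccatiMap A B C Q R) X := by
  have hinv := continuousAt_inv_add_transpose_mul_mul hX
  unfold riccatiMap
  fun_prop

theorem continuousAt_closedLoop (hX : IsUnit (R + Bᵀ * X * B)) :
    ContinuousAt (closedLoop A B R) X := by
  have hinv := continuousAt_inv_add_transpose_mul_mul hX
  unfold closedLoop feedbackGain
  fun_prop

theorem IsObservable.eq_zero_of_forall (h : IsObservable A C) {x : Fin n → ℝ}
    (hx : ∀ i < n, C *ᵥ (A ^ i *ᵥ x) = 0) : x = 0 := by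
  have hrank : Module.finrank ℝ (LinearMap.range (obsvMatrix A C).mulVecLin) = n := h
  have hker : LinearMap.ker (obsvMatrix A C).mulVecLin = ⊥ := by
    have hdim := LinearMap.finrank_range_add_finrank_ker (obsvMatrix A C).mulVecLin
    rw [Module.finrank_fin_fun, hrank] at hdim
    exact Submodule.finrank_eq_zero.mp (by omega)
  refine LinearMap.ker_eq_bot'.mp hker x ?_
  ext ⟨i, r⟩
  have hxr := congrFun (hx i i.isLt) r
  rw [Matrix.mulVec_mulVec] at hxr
  exact hxr

/- Zero cost over `n` steps forces the input `K x` to vanish, so the closed loop runs like `A` and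
observability applies. -/
theorem gramian_stageCost_posDef (hQ : Q.PosSemidef) (hR : R.PosDef)
    (hAQC : IsObservable A (Q * C)) (K : Matrix (Fin m) (Fin n) ℝ) :
    (gramian (A - B * K) (stageCost C Q R 1 K) n).PosDef := by
  set F := A - B * K
  have hV := stageCost_posSemidef (C := C) hQ hR.posSemidef (1 : Matrix (Fin n) (Fin n) ℝ) K
  refine posDef_of_forall_mulVec_eq_zero (gramian_posSemidef hV F n) fun x hx => ?_
  have hcost (j : ℕ) (hj : j < n) : K *ᵥ (F ^ j *ᵥ x) = 0 ∧ (Q * C) *ᵥ (F ^ j *ᵥ x) = 0 := by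
    simpa only [Matrix.one_mulVec] using mulVec_eq_zero_of_stageCost_mulVec hQ hR
      (mulVec_pow_mulVec_eq_zero_of_gramian hV hx hj)
  have hpow (j : ℕ) (hj : j < n) : F ^ j *ᵥ x = A ^ j *ᵥ x := by
    induction j with
    | zero => rw [pow_zero, pow_zero]
    | succ j ih =>
      have hj' : j < n := j.lt_succ_self.trans hj
      rw [pow_succ', pow_succ', ← Matrix.mulVec_mulVec, ← Matrix.mulVec_mulVec, ← ih hj',
        Matrix.sub_mulVec, ← Matrix.mulVec_mulVec, (hcost j hj').1, Matrix.mulVec_zero, sub_zero]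
  refine hAQC.eq_zero_of_forall fun j hj => ?_
  rw [← hpow j hj]
  exact (hcost j hj).2

end Riccati

section Controllability

variable {n m : ℕ} {p : Type*} {A : Matrix (Fin n) (Fin n) ℝ} {B : Matrix (Fin n) (Fin m) ℝ}

/-- The trajectory `Z (k + 1) = A Z k + B U k` from `Z 0 = Z₀`. The states and inputs are matrices,
so that a single trajectory comprises one for each column of `Z₀`. -/
def trajectory (A : Matrix (Fin n) (Fin n) ℝ) (B : Matrix (Fin n) (Fin m) ℝ)
    (U : ℕ → Matrix (Fin m) p ℝ) (Z₀ : Matrix (Fin n) p ℝ) : ℕ → Matrix (Fin n) p ℝ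
  | 0 => Z₀
  | k + 1 => A * trajectory A B U Z₀ k + B * U k

theorem trajectory_eq_add_sum (U : ℕ → Matrix (Fin m) p ℝ) (Z₀ : Matrix (Fin n) p ℝ) (k : ℕ) :
    trajectory A B U Z₀ k =
      A ^ k * Z₀ + ∑ j ∈ Finset.range k, A ^ (k - 1 - j) * (B * U j) := by
  induction k with
  | zero => simp [trajectory]
  | succ k ih =>
    have hshift : A * ∑ j ∈ Finset.range k, A ^ (k - 1 - j) * (B * U j) =
        ∑ j ∈ Finset.range k, A ^ (k - j) * (B * U j) := by
      rw [Matrix.mul_sum]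
      refine Finset.sum_congr rfl fun j hj => ?_
      have hj : k - 1 - j + 1 = k - j := by have := Finset.mem_range.mp hj; omega
      rw [← Matrix.mul_assoc, ← pow_succ', hj]
    rw [trajectory, ih, Finset.sum_range_succ, Matrix.mul_add, hshift, ← Matrix.mul_assoc,
      ← pow_succ', Nat.add_sub_cancel, Nat.sub_self, pow_zero, Matrix.one_mul, add_assoc]

theorem ctrbMatrix_mul (V : Matrix (Fin n × Fin m) p ℝ) :
    ctrbMatrix A B * V =
      ∑ j : Fin n, A ^ (n - 1 - (j : ℕ)) * (B * V.submatrix (Prod.mk j) id) := by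
  ext r c
  rw [Matrix.sum_apply, Matrix.mul_apply, Fintype.sum_prod_type]
  refine Finset.sum_congr rfl fun j _ => ?_
  rw [← Matrix.mul_assoc, Matrix.mul_apply]
  rfl

theorem IsControllable.exists_ctrbMatrix_mul_eq (h : IsControllable A B)
    (Z : Matrix (Fin n) p ℝ) : ∃ V : Matrix (Fin n × Fin m) p ℝ, ctrbMatrix A B * V = Z := by
  have hrange : LinearMap.range (ctrbMatrix A B).mulVecLin = ⊤ :=
    Submodule.eq_top_of_finrank_eq (h.trans (Module.finrank_fin_fun ℝ).symm)
  obtain ⟨G, hG⟩ :=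
    Matrix.mulVec_surjective_iff_exists_right_inverse.mp (LinearMap.range_eq_top.mp hrange)
  exact ⟨G * Z, by rw [← Matrix.mul_assoc, hG, Matrix.one_mul]⟩

theorem IsControllable.exists_trajectory_eq (h : IsControllable A B)
    (Z₀ Z₁ : Matrix (Fin n) p ℝ) : ∃ U, trajectory A B U Z₀ n = Z₁ := by
  obtain ⟨V, hV⟩ := h.exists_ctrbMatrix_mul_eq (Z₁ - A ^ n * Z₀)
  refine ⟨fun j => if hj : j < n then V.submatrix (Prod.mk ⟨j, hj⟩) id else 0, ?_⟩
  rw [trajectory_eq_add_sum, Finset.sum_range]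
  simp only [Fin.is_lt, dite_true, Fin.eta]
  rw [← ctrbMatrix_mul, hV, add_sub_cancel]

end Controllability

section ValueIteration

variable {n m l : ℕ} {A : Matrix (Fin n) (Fin n) ℝ} {B : Matrix (Fin n) (Fin m) ℝ}
  {C : Matrix (Fin l) (Fin n) ℝ} {Q : Matrix (Fin l) (Fin l) ℝ} {R : Matrix (Fin m) (Fin m) ℝ}
  {X P : Matrix (Fin n) (Fin n) ℝ}

theorem iterate_riccatiMap_posSemidef (hQ : Q.PosSemidef) (hR : R.PosDef) (hX : X.PosSemidef)
    (k : ℕ) : ((riccatiMap A B C Q R)^[k] X).PosSemidef :=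
  Function.Iterate.rec Matrix.PosSemidef hX (fun _ => riccatiMap_posSemidef hQ hR) k

/- Dynamic programming: `(riccatiMap A B C Q R)^[k] X` is the optimal `k`-step cost with terminal
weight `X`, so it is at most the cost of any trajectory. -/
theorem transpose_mul_iterate_riccatiMap_mul_le {p : Type*} [Finite p] (hQ : Q.PosSemidef)
    (hR : R.PosDef) (hX : X.PosSemidef) (U : ℕ → Matrix (Fin m) p ℝ) (Z₀ : Matrix (Fin n) p ℝ)
    (k : ℕ) :
    Z₀ᵀ * (riccatiMap A B C Q R)^[k] X * Z₀ ≤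
      (trajectory A B U Z₀ k)ᵀ * X * trajectory A B U Z₀ k +
        ∑ i ∈ Finset.range k, stageCost C Q R (trajectory A B U Z₀ i) (U i) := by
  induction k generalizing X with
  | zero => simp [trajectory]
  | succ k ih =>
    set Z := trajectory A B U Z₀
    calc Z₀ᵀ * (riccatiMap A B C Q R)^[k + 1] X * Z₀
        ≤ (Z k)ᵀ * riccatiMap A B C Q R X * Z k +
          ∑ i ∈ Finset.range k, stageCost C Q R (Z i) (U i) :=
          ih (riccatiMap_posSemidef hQ hR hX)
      _ ≤ (Z (k + 1))ᵀ * X * Z (k + 1) + stageCost C Q R (Z k) (U k) +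
          ∑ i ∈ Finset.range k, stageCost C Q R (Z i) (U i) := by
          gcongr
          exact transpose_mul_riccatiMap_mul_le hR hX (Z k) (U k)
      _ = (Z (k + 1))ᵀ * X * Z (k + 1) +
          ∑ i ∈ Finset.range (k + 1), stageCost C Q R (Z i) (U i) := by
          rw [Finset.sum_range_succ_comm, add_assoc]

theorem IsControllable.exists_forall_iterate_riccatiMap_le (hAB : IsControllable A B)
    (hQ : Q.PosSemidef) (hR : R.PosDef) :
    ∃ W, ∀ X : Matrix (Fin n) (Fin n) ℝ, X.PosSemidef → (riccatiMap A B C Q R)^[n] X ≤ W := by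
  obtain ⟨U, hU⟩ := hAB.exists_trajectory_eq 1 (0 : Matrix (Fin n) (Fin n) ℝ)
  refine ⟨∑ i ∈ Finset.range n, stageCost C Q R (trajectory A B U 1 i) (U i), fun X hX => ?_⟩
  simpa only [hU, Matrix.transpose_one, Matrix.one_mul, Matrix.mul_one, Matrix.mul_zero, zero_add]
    using transpose_mul_iterate_riccatiMap_mul_le (A := A) (B := B) (C := C) hQ hR hX U 1 n

theorem monotone_iterate_riccatiMap (hQ : Q.PosSemidef) (hR : R.PosDef) (hX : X.PosSemidef)
    (hle : X ≤ riccatiMap A B C Q R X) : Monotone fun k => (riccatiMap A B C Q R)^[k] X := by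
  refine monotone_nat_of_le_succ fun k => ?_
  have hpos := iterate_riccatiMap_posSemidef (A := A) (B := B) (C := C) hQ hR hX
  induction k with
  | zero => exact hle
  | succ k ih =>
    rw [Function.iterate_succ_apply' _ k, Function.iterate_succ_apply' _ (k + 1)]
    exact riccatiMap_mono hR (hpos k) (hpos (k + 1)) ih

theorem IsControllable.exists_tendsto_iterate_riccatiMap (hAB : IsControllable A B)
    (hQ : Q.PosSemidef) (hR : R.PosDef) (hX : X.PosSemidef)
    (hle : X ≤ riccatiMap A B C Q R X) :
    ∃ P, Tendsto (fun k => (riccatiMap A B C Q R)^[k] X) atTop (𝓝 P) := by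
  have hmono := monotone_iterate_riccatiMap hQ hR hX hle
  obtain ⟨W, hW⟩ := hAB.exists_forall_iterate_riccatiMap_le (C := C) hQ hR
  refine exists_tendsto_of_monotone hmono ⟨W, Set.forall_mem_range.mpr fun k => ?_⟩
  calc (riccatiMap A B C Q R)^[k] X ≤ (riccatiMap A B C Q R)^[n + k] X :=
        hmono (Nat.le_add_left k n)
    _ = (riccatiMap A B C Q R)^[n] ((riccatiMap A B C Q R)^[k] X) :=
        Function.iterate_add_apply _ n k X
    _ ≤ W := hW _ (iterate_riccatiMap_posSemidef hQ hR hX k)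

theorem posSemidef_of_tendsto_iterate_riccatiMap (hQ : Q.PosSemidef) (hR : R.PosDef)
    (hX : X.PosSemidef) (hlim : Tendsto (fun k => (riccatiMap A B C Q R)^[k] X) atTop (𝓝 P)) :
    P.PosSemidef :=
  isClosed_setOf_posSemidef.mem_of_tendsto hlim
    (.of_forall (iterate_riccatiMap_posSemidef hQ hR hX))

theorem isFixedPt_of_tendsto_iterate_riccatiMap (hQ : Q.PosSemidef) (hR : R.PosDef)
    (hX : X.PosSemidef) (hlim : Tendsto (fun k => (riccatiMap A B C Q R)^[k] X) atTop (𝓝 P)) :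
    Function.IsFixedPt (riccatiMap A B C Q R) P :=
  isFixedPt_of_tendsto_iterate hlim (continuousAt_riccatiMap (isUnit_add_transpose_mul_mul hR
    (posSemidef_of_tendsto_iterate_riccatiMap hQ hR hX hlim)))

theorem sub_closedLoop_eq_stageCost (hR : R.PosDef) (hP : P.PosSemidef)
    (hfix : Function.IsFixedPt (riccatiMap A B C Q R) P) :
    P - (closedLoop A B R P)ᵀ * P * closedLoop A B R P =
      stageCost C Q R 1 (feedbackGain A B R P) := by
  nth_rw 1 [← hfix.eq]
  rw [riccatiMap_eq_closedLoop (isUnit_add_transpose_mul_mul hR hP), add_sub_cancel_left]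

theorem gramian_sub_closedLoop_posDef (hQ : Q.PosSemidef) (hR : R.PosDef)
    (hAQC : IsObservable A (Q * C)) (hP : P.PosSemidef)
    (hfix : Function.IsFixedPt (riccatiMap A B C Q R) P) :
    (gramian (closedLoop A B R P)
      (P - (closedLoop A B R P)ᵀ * P * closedLoop A B R P) n).PosDef := by
  rw [sub_closedLoop_eq_stageCost hR hP hfix]
  exact gramian_stageCost_posDef hQ hR hAQC _

theorem posDef_of_isFixedPt_riccatiMap (hQ : Q.PosSemidef) (hR : R.PosDef)
    (hAQC : IsObservable A (Q * C)) (hP : P.PosSemidef)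
    (hfix : Function.IsFixedPt (riccatiMap A B C Q R) P) : P.PosDef :=
  posDef_of_gramian_posDef hP (gramian_sub_closedLoop_posDef hQ hR hAQC hP hfix)

theorem exists_isBigO_closedLoop_pow (hQ : Q.PosSemidef) (hR : R.PosDef)
    (hAQC : IsObservable A (Q * C)) (hP : P.PosSemidef)
    (hfix : Function.IsFixedPt (riccatiMap A B C Q R) P) :
    ∃ μ ∈ Set.Ioo (0 : ℝ) 1, (fun k : ℕ => closedLoop A B R P ^ k) =O[atTop] fun k => μ ^ k :=
  exists_isBigO_pow_of_gramian_posDef hP (gramian_sub_closedLoop_posDef hQ hR hAQC hP hfix)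

end ValueIteration

section Rate

variable {n m l : ℕ} {A : Matrix (Fin n) (Fin n) ℝ} {B : Matrix (Fin n) (Fin m) ℝ}
  {C : Matrix (Fin l) (Fin n) ℝ} {Q : Matrix (Fin l) (Fin l) ℝ} {R : Matrix (Fin m) (Fin m) ℝ}
  {X P P' : Matrix (Fin n) (Fin n) ℝ}

/-- The product of the closed-loop matrices of the first `k` Riccati iterates of `X`. The factors
are ordered by the number of remaining steps, so the matrix of the latest iterate, which acts
first, stands on the right. -/
noncomputable def transition (A : Matrix (Fin n) (Fin n) ℝ) (B : Matrix (Fin n) (Fin m) ℝ)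
    (C : Matrix (Fin l) (Fin n) ℝ) (Q : Matrix (Fin l) (Fin l) ℝ) (R : Matrix (Fin m) (Fin m) ℝ)
    (X : Matrix (Fin n) (Fin n) ℝ) : ℕ → Matrix (Fin n) (Fin n) ℝ
  | 0 => 1
  | k + 1 => transition A B C Q R X k * closedLoop A B R ((riccatiMap A B C Q R)^[k] X)

theorem transition_transpose_mul_mul_le (hQ : Q.PosSemidef) (hR : R.PosDef) (hX : X.PosSemidef)
    (k : ℕ) :
    (transition A B C Q R X k)ᵀ * X * transition A B C Q R X k ≤
      (riccatiMap A B C Q R)^[k] X := by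
  induction k with
  | zero => simp [transition]
  | succ k ih =>
    set Xk := (riccatiMap A B C Q R)^[k] X
    set Φ := transition A B C Q R X k
    calc (transition A B C Q R X (k + 1))ᵀ * X * transition A B C Q R X (k + 1)
        = (closedLoop A B R Xk)ᵀ * (Φᵀ * X * Φ) * closedLoop A B R Xk := by
          simp only [transition, Matrix.transpose_mul, Matrix.mul_assoc]
          rfl
      _ ≤ (closedLoop A B R Xk)ᵀ * Xk * closedLoop A B R Xk := transpose_mul_mul_mono ih _
      _ ≤ riccatiMap A B C Q R Xk := closedLoop_mul_mul_le_riccatiMap hQ hR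
          (iterate_riccatiMap_posSemidef hQ hR hX k)
      _ = (riccatiMap A B C Q R)^[k + 1] X := (Function.iterate_succ_apply' _ k X).symm

theorem sub_iterate_riccatiMap_eq (hQ : Q.PosSemidef) (hR : R.PosDef) (hX : X.PosSemidef)
    (hP : P.PosSemidef) (hfix : Function.IsFixedPt (riccatiMap A B C Q R) P) (k : ℕ) :
    P - (riccatiMap A B C Q R)^[k] X =
      (closedLoop A B R P ^ k)ᵀ * (P - X) * transition A B C Q R X k := by
  induction k with
  | zero => simp [transition]
  | succ k ih =>
    have hXk := iterate_riccatiMap_posSemidef (A := A) (B := B) (C := C) hQ hR hX k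
    calc P - (riccatiMap A B C Q R)^[k + 1] X
        = riccatiMap A B C Q R P - riccatiMap A B C Q R ((riccatiMap A B C Q R)^[k] X) := by
          rw [hfix.eq, Function.iterate_succ_apply']
      _ = (closedLoop A B R P)ᵀ * (P - (riccatiMap A B C Q R)^[k] X) *
          closedLoop A B R ((riccatiMap A B C Q R)^[k] X) :=
          riccatiMap_sub_riccatiMap (Matrix.isHermitian_iff_isSymm.mp hR.isHermitian)
            (Matrix.isHermitian_iff_isSymm.mp hP.isHermitian)
            (isUnit_add_transpose_mul_mul hR hXk) (isUnit_add_transpose_mul_mul hR hP)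
      _ = (closedLoop A B R P ^ (k + 1))ᵀ * (P - X) * transition A B C Q R X (k + 1) := by
          rw [ih, pow_succ, Matrix.transpose_mul, transition]
          simp only [Matrix.mul_assoc]

theorem isBigO_one_transition (hQ : Q.PosSemidef) (hR : R.PosDef) (hX : X.PosDef)
    (hbdd : (fun k => (riccatiMap A B C Q R)^[k] X) =O[atTop] fun _ => (1 : ℝ)) :
    transition A B C Q R X =O[atTop] fun _ => (1 : ℝ) := by
  obtain ⟨c, hc, hnorm⟩ := exists_norm_sq_le_mul_norm hX
  have hle (k : ℕ) : ‖transition A B C Q R X k‖ ^ 2 ≤ c * ‖(riccatiMap A B C Q R)^[k] X‖ := by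
    refine (hnorm _).trans (mul_le_mul_of_nonneg_left ?_ hc.le)
    exact norm_le_norm_of_le (posSemidef_transpose_mul_mul hX.posSemidef _)
      (transition_transpose_mul_mul_le hQ hR hX.posSemidef k)
  have hsq : (fun k => ‖transition A B C Q R X k‖ ^ 2) =O[atTop] fun _ => (1 : ℝ) ^ 2 := by
    rw [one_pow]
    refine (IsBigO.of_bound c (.of_forall fun k => ?_)).trans hbdd
    rw [Real.norm_of_nonneg (by positivity)]
    exact hle k
  exact (hsq.of_pow two_ne_zero).of_norm_left

theorem isBigO_sub_iterate_riccatiMap {μ : ℝ} (hQ : Q.PosSemidef) (hR : R.PosDef)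
    (hX : X.PosDef) (hP : P.PosSemidef) (hfix : Function.IsFixedPt (riccatiMap A B C Q R) P)
    (hF : (fun k => closedLoop A B R P ^ k) =O[atTop] fun k => μ ^ k)
    (hbdd : (fun k => (riccatiMap A B C Q R)^[k] X) =O[atTop] fun _ => (1 : ℝ)) :
    (fun k => P - (riccatiMap A B C Q R)^[k] X) =O[atTop] fun k => μ ^ k := by
  have hFt : (fun k => (closedLoop A B R P ^ k)ᵀ) =O[atTop] fun k => μ ^ k := by
    refine IsBigO.trans (IsBigO.of_norm_le fun k => ?_) hF.norm_left
    rw [← Matrix.conjTranspose_eq_transpose_of_trivial, Matrix.l2_opNorm_conjTranspose]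
  simp only [sub_iterate_riccatiMap_eq hQ hR hX.posSemidef hP hfix]
  simpa only [mul_one] using isBigO_matrix_mul
    (isBigO_matrix_mul hFt (isBigO_const_const (P - X) (one_ne_zero' ℝ) atTop))
    (isBigO_one_transition hQ hR hX hbdd)

theorem eq_of_isFixedPt_riccatiMap (hQ : Q.PosSemidef) (hR : R.PosDef)
    (hAQC : IsObservable A (Q * C)) (hP : P.PosSemidef) (hP' : P'.PosSemidef)
    (hfix : Function.IsFixedPt (riccatiMap A B C Q R) P)
    (hfix' : Function.IsFixedPt (riccatiMap A B C Q R) P') : P = P' := by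
  obtain ⟨μ, hμ, hF⟩ := exists_isBigO_closedLoop_pow hQ hR hAQC hP hfix
  have hiter (k : ℕ) : (riccatiMap A B C Q R)^[k] P' = P' := hfix'.iterate k
  have hrate : (fun _ : ℕ => P - P') =O[atTop] fun k => μ ^ k := by
    simpa only [hiter] using isBigO_sub_iterate_riccatiMap hQ hR
      (posDef_of_isFixedPt_riccatiMap hQ hR hAQC hP' hfix') hP hfix hF
      (by simpa only [hiter] using isBigO_const_const P' (one_ne_zero' ℝ) atTop)
  have hlim : Tendsto (fun _ : ℕ => P - P') atTop (𝓝 0) :=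
    hrate.trans_tendsto (tendsto_pow_atTop_nhds_zero_of_lt_one hμ.1.le hμ.2)
  exact sub_eq_zero.mp (tendsto_const_nhds_iff.mp hlim)

theorem exists_isBigO_sub_iterate_riccatiMap (hQ : Q.PosSemidef) (hR : R.PosDef)
    (hAQC : IsObservable A (Q * C)) (hX : X.PosSemidef)
    (hlim : Tendsto (fun k => (riccatiMap A B C Q R)^[k] X) atTop (𝓝 P)) :
    ∃ μ ∈ Set.Ioo (0 : ℝ) 1,
      (fun k => P - (riccatiMap A B C Q R)^[k] X) =O[atTop] fun k => μ ^ k := by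
  have hP := posSemidef_of_tendsto_iterate_riccatiMap hQ hR hX hlim
  have hfix := isFixedPt_of_tendsto_iterate_riccatiMap hQ hR hX hlim
  obtain ⟨μ, hμ, hF⟩ := exists_isBigO_closedLoop_pow hQ hR hAQC hP hfix
  obtain ⟨N, hN⟩ := (eventually_posDef_of_tendsto
    (fun k => (iterate_riccatiMap_posSemidef hQ hR hX k).isHermitian)
    (posDef_of_isFixedPt_riccatiMap hQ hR hAQC hP hfix) hlim).exists
  refine ⟨μ, hμ, isBigO_pow_of_shift hμ.1.ne' N ?_⟩
  simp only [Function.iterate_add_apply]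
  refine isBigO_sub_iterate_riccatiMap hQ hR hN hP hfix hF ?_
  simpa only [Function.iterate_add_apply] using
    ((tendsto_add_atTop_iff_nat N).mpr hlim).isBigO_one ℝ

theorem exists_isBigO_feedbackGain_sub (hQ : Q.PosSemidef) (hR : R.PosDef)
    (hAQC : IsObservable A (Q * C)) (hX : X.PosSemidef)
    (hlim : Tendsto (fun k => (riccatiMap A B C Q R)^[k] X) atTop (𝓝 P)) :
    ∃ μ ∈ Set.Ioo (0 : ℝ) 1,
      (fun k => feedbackGain A B R P - feedbackGain A B R ((riccatiMap A B C Q R)^[k] X))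
        =O[atTop] fun k => μ ^ k := by
  obtain ⟨μ, hμ, hrate⟩ := exists_isBigO_sub_iterate_riccatiMap hQ hR hAQC hX hlim
  have hPunit := isUnit_add_transpose_mul_mul (B := B) hR
    (posSemidef_of_tendsto_iterate_riccatiMap hQ hR hX hlim)
  have hF := ((continuousAt_closedLoop (A := A) hPunit).tendsto.comp hlim).isBigO_one ℝ
  refine ⟨μ, hμ, ?_⟩
  simp only [feedbackGain_sub_feedbackGain (isUnit_add_transpose_mul_mul hR
    (iterate_riccatiMap_posSemidef hQ hR hX _)) hPunit]
  simpa only [one_mul, mul_one, Function.comp_apply] using isBigO_matrix_mul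
    (isBigO_const_const ((R + Bᵀ * P * B)⁻¹ * Bᵀ) (one_ne_zero' ℝ) atTop)
    (isBigO_matrix_mul hrate hF)

theorem norm_gainLQR_sub_gainLQRStar_le {T k : ℕ} (hk : k + 1 ≤ T) :
    ‖gainLQR A B C Q R T (T - (k + 1)) - gainLQRStar A B C R P‖ ≤
      ‖feedbackGain A B R P - feedbackGain A B R ((riccatiMap A B C Q R)^[k] (Cᵀ * Q * C))‖ *
        ‖windowMatrix A B C‖ := by
  have hiter : T - (T - (k + 1) + 1) = k := by omega
  rw [gainLQR, gainLQRStar, riccatiP, hiter, norm_sub_rev, ← Matrix.sub_mul]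
  exact Matrix.l2_opNorm_mul _ _

end Rate

end LQR

/-- `‖·‖` is the spectral norm (the operator norm induced by the Euclidean norms). -/
theorem mainTheorem3 {n m l : ℕ}
    (A : Matrix (Fin n) (Fin n) ℝ) (B : Matrix (Fin n) (Fin m) ℝ) (C : Matrix (Fin l) (Fin n) ℝ)
    (Q : Matrix (Fin l) (Fin l) ℝ) (R : Matrix (Fin m) (Fin m) ℝ)
    (hAB : LQR.IsControllable A B) (hAC : LQR.IsObservable A C)
    (hQ : Q.PosSemidef) (hR : R.PosDef) (hAQC : LQR.IsObservable A (Q * C)) :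
    ∃ Pstar : Matrix (Fin n) (Fin n) ℝ,
      LQR.IsPosDefDARESolution A B C Q R Pstar ∧
      (∀ P : Matrix (Fin n) (Fin n) ℝ, LQR.IsPosDefDARESolution A B C Q R P → P = Pstar) ∧
      ∃ c₁ c₂ μ : ℝ, 0 < c₁ ∧ 0 < c₂ ∧ 0 < μ ∧ μ < 1 ∧
        ∀ T t : ℕ, 1 ≤ t → t ≤ T →
          ‖LQR.gainLQR A B C Q R T (T - t) - LQR.gainLQRStar A B C R Pstar‖ ≤ c₁ * c₂ * μ ^ t := by
  have hX := LQR.posSemidef_transpose_mul_mul hQ C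
  obtain ⟨P, hlim⟩ := hAB.exists_tendsto_iterate_riccatiMap hQ hR hX (LQR.le_riccatiMap hR hX)
  have hP := LQR.posSemidef_of_tendsto_iterate_riccatiMap hQ hR hX hlim
  have hfix := LQR.isFixedPt_of_tendsto_iterate_riccatiMap hQ hR hX hlim
  obtain ⟨μ, ⟨hμ0, hμ1⟩, hrate⟩ := LQR.exists_isBigO_feedbackGain_sub hQ hR hAQC hX hlim
  obtain ⟨c, hc, hgain⟩ := Asymptotics.bound_of_isBigO_nat_atTop hrate
  refine ⟨P, ⟨LQR.posDef_of_isFixedPt_riccatiMap hQ hR hAQC hP hfix, hfix.eq.symm⟩,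
    fun P' hP' => LQR.eq_of_isFixedPt_riccatiMap hQ hR hAQC hP'.1.posSemidef hP hP'.2.symm hfix,
    c / μ, ‖LQR.windowMatrix A B C‖ + 1, μ, by positivity, by positivity, hμ0, hμ1,
    fun T t ht htT => ?_⟩
  obtain ⟨k, rfl⟩ := Nat.exists_eq_add_of_le' ht
  have hgain_k := hgain (pow_pos hμ0 k).ne'
  rw [Real.norm_of_nonneg (pow_nonneg hμ0.le k)] at hgain_k
  calc _ ≤ c * μ ^ k * (‖LQR.windowMatrix A B C‖ + 1) :=
        (LQR.norm_gainLQR_sub_gainLQRStar_le htT).trans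
          (mul_le_mul hgain_k (le_add_of_nonneg_right zero_le_one) (norm_nonneg _) (by positivity))
    _ = c / μ * (‖LQR.windowMatrix A B C‖ + 1) * μ ^ (k + 1) := by
        rw [pow_succ]
        field_simp
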